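/- Let $S$ be a densely defined symmetric operator on a complex Hilbert space $\mathcal{H}$ (not assumed separable) with domain $\mathcal{D}(S)$, and let $J\subset\mathbb{R}$ be a gap of $S$, that is, an open interval of one of the following forms: $J=(a,b)$ with $-\infty<a<b<\infty$ and $\big\|\big(S-\tfrac{a+b}{2}\big)f\big\|\ge\tfrac{b-a}{2}\|f\|$ for all $f\in\mathcal{D}(S)$; or $J=(-\infty,b)$ with $b\in\mathbb{R}$ and $\langle f,Sf\rangle\ge b\|f\|^2$ for all $f\in\mathcal{D}(S)$; or $J=(a,\infty)$ with $a\in\mathbb{R}$ and $\langle f,Sf\rangle\le a\|f\|^2$ for all $f\in\mathcal{D}(S)$. Assume that $S$ has infinite deficiency index, that is, $\ker(S^*-i)$ and $\ker(S^*+i)$ are both infinite-dimensional. Then for every closed set $K\subseteq\overline{J}$ (closure in $\mathbb{R}$) there is a self-adjoint extension $A$ of $S$ in $\mathcal{H}$ with $K\subseteq\sigma_{\mathrm{ess}}(A)$, where $\sigma_{\mathrm{ess}}(A)$ is the spectrum of $A$ without the isolated points of the spectrum that are eigenvalues of finite multiplicity. -/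

import Mathlib

noncomputable section

namespace UnboundedOperator

variable {H : Type*} [NormedAddCommGroup H] [InnerProductSpace ℂ H]

/-- The symmetric operator `S` has the open interval `J` (bounded or a half-line) as a gap:
* `J = (-∞, b)` and `⟪f, S f⟫ ≥ b ‖f‖²` for all `f` in the domain, or
* `J = (a, b)` with `a < b` and `‖(S - (a + b) / 2) f‖ ≥ (b - a) / 2 * ‖f‖`
  for all `f` in the domain, or
* `J = (a, ∞)` and `⟪f, S f⟫ ≤ a ‖f‖²` for all `f` in the domain.
(For symmetric `S` the number `⟪f, S f⟫` is real, so taking the real part is harmless.) -/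
def HasGap (S : H →ₗ.[ℂ] H) (J : Set ℝ) : Prop :=
  (∃ b : ℝ, J = Set.Iio b ∧
    ∀ f : S.domain, b * ‖(f : H)‖ ^ 2 ≤ (inner ℂ (f : H) (S f)).re) ∨
  (∃ a b : ℝ, a < b ∧ J = Set.Ioo a b ∧
    ∀ f : S.domain,
      (b - a) / 2 * ‖(f : H)‖ ≤ ‖S f - (((a + b) / 2 : ℝ) : ℂ) • (f : H)‖) ∨
  (∃ a : ℝ, J = Set.Ioi a ∧
    ∀ f : S.domain, (inner ℂ (f : H) (S f)).re ≤ a * ‖(f : H)‖ ^ 2)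

/-- The eigenspace `ker (A - z)` of the operator `A`. -/
def eigenspace (A : H →ₗ.[ℂ] H) (z : ℂ) : Submodule ℂ H where
  carrier := {f | ∃ hf : f ∈ A.domain, A ⟨f, hf⟩ = z • f}
  zero_mem' := ⟨A.domain.zero_mem, by
    rw [smul_zero]
    exact A.map_zero⟩
  add_mem' := by
    rintro f g ⟨hf, hf'⟩ ⟨hg, hg'⟩
    refine ⟨A.domain.add_mem hf hg, ?_⟩
    rw [smul_add, ← hf', ← hg']
    exact A.map_add ⟨f, hf⟩ ⟨g, hg⟩
  smul_mem' := by
    rintro c f ⟨hf, hf'⟩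
    refine ⟨A.domain.smul_mem c hf, ?_⟩
    rw [smul_comm, ← hf']
    exact A.map_smul c ⟨f, hf⟩

/-- Both deficiency indices `dim ker (S* - i)` and `dim ker (S* + i)` are infinite. -/
def HasInfiniteDeficiencyIndex [CompleteSpace H] (S : H →ₗ.[ℂ] H) : Prop :=
  ¬ FiniteDimensional ℂ (eigenspace S.adjoint Complex.I) ∧
  ¬ FiniteDimensional ℂ (eigenspace S.adjoint (-Complex.I))

/-- The resolvent set: `A - z` maps the domain of `A` bijectively onto `H`, with an everywhere
defined bounded inverse `R`. -/
def resolventSet (A : H →ₗ.[ℂ] H) : Set ℂ :=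
  {z | ∃ R : H →L[ℂ] H,
    (∀ g : H, ∃ hg : R g ∈ A.domain, A ⟨R g, hg⟩ - z • R g = g) ∧
    (∀ f : A.domain, R (A f - z • (f : H)) = f)}

/-- The spectrum of `A`. -/
def spectrum (A : H →ₗ.[ℂ] H) : Set ℂ := (resolventSet A)ᶜ

/-- The discrete spectrum of a self-adjoint operator: the isolated points of the spectrum which
are eigenvalues of finite multiplicity. -/
def discreteSpectrum (A : H →ₗ.[ℂ] H) : Set ℂ :=
  {z | z ∈ spectrum A ∧ ¬ AccPt z (Filter.principal (spectrum A)) ∧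
    eigenspace A z ≠ ⊥ ∧ FiniteDimensional ℂ (eigenspace A z)}

/-- The essential spectrum of a self-adjoint operator: the complement, in the spectrum, of the
discrete spectrum. -/
def essentialSpectrum (A : H →ₗ.[ℂ] H) : Set ℂ := spectrum A \ discreteSpectrum A

end UnboundedOperator

end

namespace UnboundedOperator

open InnerProductSpace ContinuousLinearMap

variable {H : Type*} [NormedAddCommGroup H] [InnerProductSpace ℂ H]

/-! One extension handles all of `closure J`: it gets a dense sequence `μ n` of points of `J` as
eigenvalues. At a gap point `S - μ n` is bounded below, and the infinite deficiency at `i` carries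
over to `μ n`: the orthogonal complement of the range of `S - μ n`, which is `ker (S* - μ n)`, is
infinite dimensional (`not_finiteDimensional_orthogonal_range_sub`). Hence orthonormal `e n ∈ ker
(S* - μ n)` exist.

Let `P` project onto the closed span of the `e n`. Since all `μ n` lie in the gap, Parseval shows
that removing the `P`-component costs no more than the gap inequality provides, so the compression
of `S` to the complement is still bounded below at some real `c`
(`HasGap.exists_bound_compression`). Its shifted inverse is then a bounded symmetric partial map and
extends to a bounded self-adjoint `B` with `B (e n) = 0` (`exists_selfAdjoint_extension_of_bound`).
The sum of `diag (μ n)` and `c + B⁻¹` is a self-adjoint extension of `S` whose spectrum contains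
`closure J`; this set is perfect, so all of it is essential spectrum. -/

/-- A sequence of infinite dimensional subspaces admits an orthonormal system of representatives. -/
theorem exists_orthonormal_mem {V : ℕ → Submodule ℂ H} (hV : ∀ n, ¬ FiniteDimensional ℂ (V n)) :
    ∃ e : ℕ → H, Orthonormal ℂ e ∧ ∀ n, e n ∈ V n := by
  classical
  have hpick : ∀ (n : ℕ) (s : Finset H), ∃ x ∈ V n, ‖x‖ = 1 ∧ ∀ y ∈ s, inner ℂ y x = 0 := by
    intro n s
    set W : Submodule ℂ H := Submodule.span ℂ (s : Set H) with hW
    have : FiniteDimensional ℂ W := FiniteDimensional.span_finset ℂ s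
    have hker : LinearMap.ker
        ((W.orthogonalProjectionOnto : H →ₗ[ℂ] W) ∘ₗ (V n).subtype) ≠ ⊥ := fun h =>
      hV n (Module.Finite.of_injective _ (LinearMap.ker_eq_bot.1 h))
    obtain ⟨x, hx, hx0⟩ := Submodule.exists_mem_ne_zero_of_ne_bot hker
    have hxW : (x : H) ∈ Wᗮ := Submodule.orthogonalProjectionOnto_eq_zero_iff.1 hx
    have hx0' : (x : H) ≠ 0 := fun h => hx0 (Subtype.ext h)
    refine ⟨((‖(x : H)‖⁻¹ : ℝ) : ℂ) • (x : H), (V n).smul_mem _ x.2, ?_, fun y hy => ?_⟩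
    · rw [norm_smul, Complex.norm_real, norm_inv, norm_norm,
        inv_mul_cancel₀ (norm_ne_zero_iff.2 hx0')]
    · rw [inner_smul_right, (Submodule.mem_orthogonal _ _).1 hxW y (Submodule.subset_span hy),
        mul_zero]
  choose p hpV hp1 hp0 using hpick
  let s : ℕ → Finset H := fun n => Nat.rec ∅ (fun n s => insert (p n s) s) n
  have hs : ∀ n, s (n + 1) = insert (p n (s n)) (s n) := fun n => rfl
  have hmono : Monotone s := monotone_nat_of_le_succ fun n => by
    rw [hs]
    exact Finset.subset_insert _ _
  have hlt : ∀ m n, m < n → inner ℂ (p m (s m)) (p n (s n)) = 0 := fun m n hmn =>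
    hp0 n _ _ (hmono (Nat.succ_le_of_lt hmn) (by
      rw [Nat.succ_eq_add_one, hs]
      exact Finset.mem_insert_self _ _))
  refine ⟨fun n => p n (s n), ⟨fun n => hp1 _ _, fun m n hmn => ?_⟩, fun n => hpV _ _⟩
  rcases hmn.lt_or_gt with h | h
  · exact hlt m n h
  · exact inner_eq_zero_symm.1 (hlt n m h)

/-! ### Bounded symmetric extensions, deficiency at real points, Parseval. -/

section Complete

variable [CompleteSpace H]

/-- A symmetric linear relation `{(u f, v f)}` which is bounded, as a partial map `u f ↦ v f`,
extends to a bounded self-adjoint operator that vanishes on the vectors orthogonal to both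
components of the relation. -/
theorem exists_selfAdjoint_extension_of_bound {D : Type*} [AddCommGroup D] [Module ℂ D]
    (u v : D →ₗ[ℂ] H) {d : ℝ} (hd : 0 < d) (hbound : ∀ f, d * ‖v f‖ ≤ ‖u f‖)
    (hsymm : ∀ f g, inner ℂ (u f) (v g) = inner ℂ (v f) (u g)) :
    ∃ B : H →L[ℂ] H, (∀ x y, inner ℂ (B x) y = inner ℂ x (B y)) ∧ (∀ f, B (u f) = v f) ∧
      ∀ x, (∀ f, inner ℂ (u f) x = 0) → (∀ f, inner ℂ (v f) x = 0) → B x = 0 := by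
  set M : Submodule ℂ H := (LinearMap.range u).topologicalClosure with hM
  have : CompleteSpace M := (Submodule.isClosed_topologicalClosure _).completeSpace_coe
  have hu : ∀ f, u f ∈ M := fun f => Submodule.le_topologicalClosure _ ⟨f, rfl⟩
  set e : D →ₗ[ℂ] M := u.codRestrict M hu with he
  have hdense : DenseRange e := by
    intro x
    rw [closure_subtype]
    have h1 : ((↑) : M → H) '' Set.range e = (LinearMap.range u : Set H) := by
      ext y
      simp [he]
    rw [h1]
    exact x.2
  have hnorm : ∃ C, ∀ f, ‖v f‖ ≤ C * ‖e f‖ := by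
    refine ⟨d⁻¹, fun f => ?_⟩
    rw [inv_mul_eq_div, le_div_iff₀' hd]
    exact hbound f
  set B₀ : M →L[ℂ] H := v.extendOfNorm e with hB₀
  have hB₀e : ∀ f, B₀ (e f) = v f := fun f => LinearMap.extendOfNorm_eq hdense hnorm f
  have hB₀symm : ∀ m m' : M, inner ℂ (m : H) (B₀ m') = inner ℂ (B₀ m) (m' : H) := by
    intro m m'
    refine hdense.induction_on₂ (p := fun m m' : M =>
      inner ℂ (m : H) (B₀ m') = inner ℂ (B₀ m) (m' : H)) ?_ ?_ m m'
    · exact isClosed_eq (by fun_prop) (by fun_prop)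
    · intro f g
      rw [hB₀e, hB₀e]
      exact hsymm f g
  set Q : H →L[ℂ] H := M.starProjection with hQ
  have hQsymm : ∀ x y, inner ℂ (Q x) y = inner ℂ x (Q y) := fun x y =>
    M.starProjection_isSymmetric x y
  set T : H →L[ℂ] H := B₀ ∘L M.orthogonalProjectionOnto with hT
  have hTx : ∀ x, T x = B₀ (M.orthogonalProjectionOnto x) := fun x => rfl
  have hQx : ∀ x, Q x = (M.orthogonalProjectionOnto x : H) := fun x => rfl
  have hQT : ∀ x y, inner ℂ (Q x) (T y) = inner ℂ (T x) (Q y) := fun x y => hB₀symm _ _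
  have hQu : ∀ f, M.orthogonalProjectionOnto (u f) = e f := fun f =>
    Submodule.orthogonalProjectionOnto_mem_subspace_eq_self (e f)
  have hTu : ∀ f, T (u f) = v f := fun f => by rw [hTx, hQu, hB₀e]
  have hQu' : ∀ f, Q (u f) = u f := fun f => by rw [hQx, hQu]; rfl
  -- In blocks for `M ⊕ Mᗮ`, `T` is a first column with symmetric corner. Adding `adjoint T`
  -- supplies the missing upper right entry but doubles the corner, and `Q ∘L T` is exactly that
  -- corner; the block on `Mᗮ` stays zero.
  refine ⟨T + adjoint T - Q ∘L T, fun x y => ?_, fun f => ?_, fun x hxu hxv => ?_⟩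
  · simp only [sub_apply, add_apply, comp_apply, inner_sub_left, inner_add_left, inner_sub_right,
      inner_add_right, adjoint_inner_left, adjoint_inner_right]
    rw [hQsymm (T x) y, ← hQsymm x (T y), hQT]
    ring
  · have h1 : adjoint T (u f) = Q (v f) := by
      refine ext_inner_right ℂ fun y => ?_
      rw [adjoint_inner_left, hQsymm, ← hTu, ← hQT, hQu']
    simp only [sub_apply, add_apply, comp_apply, hTu, h1]
    abel
  · have hT0 : T x = 0 := by
      have : x ∈ Mᗮ := by
        rw [hM, Submodule.orthogonal_closure, Submodule.mem_orthogonal]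
        rintro _ ⟨f, rfl⟩
        exact hxu f
      rw [hTx, Submodule.orthogonalProjectionOnto_eq_zero_iff.2 this, map_zero]
    have hB₀x : ∀ m : M, inner ℂ (B₀ m) x = 0 := by
      intro m
      refine hdense.induction_on (p := fun m : M => inner ℂ (B₀ m) x = 0) m ?_ ?_
      · exact isClosed_eq (by fun_prop) (by fun_prop)
      · intro f
        rw [hB₀e]
        exact hxv f
    have hT1 : adjoint T x = 0 := by
      refine ext_inner_left ℂ fun y => ?_
      rw [adjoint_inner_right, inner_zero_right]
      exact hB₀x _
    simp [hT0, hT1]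

/-- If the symmetric operator `S` is bounded below at the real point `c`, the orthogonal
complement of the range of `S - c` is infinite dimensional whenever `ker (S* - i)` is. -/
theorem not_finiteDimensional_orthogonal_range_sub {S : H →ₗ.[ℂ] H}
    (hdense : Dense (S.domain : Set H)) (hsymm : S.IsFormalAdjoint S)
    (hdef : ¬ FiniteDimensional ℂ (eigenspace S.adjoint Complex.I)) (c : ℝ) {d : ℝ} (hd : 0 < d)
    (hbound : ∀ f : S.domain, d * ‖(f : H)‖ ≤ ‖S f - (c : ℂ) • (f : H)‖) :
    ¬ FiniteDimensional ℂ
      (LinearMap.range (S.toFun - (c : ℂ) • S.domain.subtype))ᗮ := by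
  intro hfin
  obtain ⟨B, hB, hBS, -⟩ := exists_selfAdjoint_extension_of_bound
    (S.toFun - (c : ℂ) • S.domain.subtype) S.domain.subtype hd hbound (by
      intro f g
      have := hsymm f g
      simp only [LinearMap.sub_apply, LinearMap.smul_apply, inner_sub_left, inner_sub_right,
        inner_smul_left, inner_smul_right, Complex.conj_ofReal, Submodule.subtype_apply]
      exact congrArg (· - _) this)
  have hadj := LinearPMap.adjoint_isFormalAdjoint hdense
  -- `B` inverts `S - c` on its range, so `1 + (c - i) B` carries `ker (S* - i)` into `ker (S* -
  -- c)`.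
  set L : H →ₗ[ℂ] H := LinearMap.id + ((c : ℂ) - Complex.I) • (B : H →ₗ[ℂ] H) with hL
  have hLx : ∀ x, L x = x + ((c : ℂ) - Complex.I) • B x := fun x => rfl
  have hmem : ∀ x : eigenspace S.adjoint Complex.I,
      L x ∈ (LinearMap.range (S.toFun - (c : ℂ) • S.domain.subtype))ᗮ := by
    rintro ⟨x, hx, hSx⟩
    rw [Submodule.mem_orthogonal']
    rintro _ ⟨f, rfl⟩
    have h1 : inner ℂ x (S f) = -Complex.I * inner ℂ x (f : H) := by
      have := hadj ⟨x, hx⟩ f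
      rw [hSx, inner_smul_left, Complex.conj_I] at this
      exact this.symm
    rw [hLx, inner_add_left, inner_smul_left, hB, hBS]
    simp only [LinearMap.sub_apply, LinearMap.smul_apply, Submodule.subtype_apply, inner_sub_right,
      inner_smul_right, map_sub, Complex.conj_ofReal, Complex.conj_I]
    change inner ℂ x (S f) - _ + _ = 0
    rw [h1]
    ring
  refine hdef (Module.Finite.of_injective
    ((L ∘ₗ Submodule.subtype _).codRestrict _ hmem) ?_)
  rw [← LinearMap.ker_eq_bot, LinearMap.ker_eq_bot']
  intro x hx
  have h0 : (x : H) + ((c : ℂ) - Complex.I) • B x = 0 := congrArg Subtype.val hx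
  -- Injectivity: pair `L x = 0` with `B x`. As `⟪B x, x⟫` is real, the imaginary part leaves `-‖B
  -- x‖² = 0`.
  have h1 : (inner ℂ (B (x : H)) ((x : H) + ((c : ℂ) - Complex.I) • B x)).im = 0 := by
    rw [h0, inner_zero_right, Complex.zero_im]
  have h2 : (inner ℂ (B x) (x : H)).im = 0 := by
    have h := inner_conj_symm (𝕜 := ℂ) (B (x : H)) (x : H)
    rw [← hB] at h
    exact Complex.conj_eq_iff_im.1 h
  have h3 : B (x : H) = 0 := by
    rw [inner_add_right, inner_smul_right, inner_self_eq_norm_sq_to_K, Complex.add_im, h2,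
      ← Complex.coe_algebraMap, ← map_pow, Complex.coe_algebraMap, Complex.im_mul_ofReal] at h1
    simpa using h1
  rw [h3, smul_zero, add_zero] at h0
  exact Subtype.ext h0

/-- Parseval's identity for the orthogonal projection onto the closed span of an orthonormal
family. -/
theorem hasSum_inner_mul_inner_starProjection {ι : Type*} {e : ι → H} (he : Orthonormal ℂ e)
    (x y : H) :
    HasSum (fun i => inner ℂ x (e i) * inner ℂ (e i) y)
      (inner ℂ ((Submodule.span ℂ (Set.range e)).topologicalClosure.starProjection x) y) := by
  set E : Submodule ℂ H := (Submodule.span ℂ (Set.range e)).topologicalClosure with hE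
  have : CompleteSpace E := (Submodule.isClosed_topologicalClosure _).completeSpace_coe
  have heE : ∀ i, e i ∈ E := fun i =>
    Submodule.le_topologicalClosure _ (Submodule.subset_span ⟨i, rfl⟩)
  let b' : ι → E := fun i => ⟨e i, heE i⟩
  have hb' : Orthonormal ℂ b' :=
    (E.subtypeₗᵢ.orthonormal_comp_iff (v := b')).1 he
  have hbot : (Submodule.span ℂ (Set.range b'))ᗮ = ⊥ := by
    rw [Submodule.eq_bot_iff]
    intro z hz
    have hle : E ≤ (ℂ ∙ (z : H))ᗮ := by
      refine Submodule.topologicalClosure_minimal _ ?_ (Submodule.isClosed_orthogonal _)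
      rw [Submodule.span_le]
      rintro _ ⟨i, rfl⟩
      rw [SetLike.mem_coe, Submodule.mem_orthogonal_singleton_iff_inner_left]
      exact (Submodule.mem_orthogonal _ _).1 hz (b' i) (Submodule.subset_span ⟨i, rfl⟩)
    exact Subtype.ext (inner_self_eq_zero.1
      (Submodule.mem_orthogonal_singleton_iff_inner_left.1 (hle z.2)))
  let b : HilbertBasis ι ℂ E := HilbertBasis.mkOfOrthogonalEqBot hb' hbot
  have hb : ∀ i, (b i : H) = e i := fun i => by
    simp [b, b']
  have h := b.hasSum_inner_mul_inner (E.orthogonalProjectionOnto x) (E.orthogonalProjectionOnto y)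
  rw [Submodule.inner_orthogonalProjectionOnto_eq_of_mem_left] at h
  refine h.congr_fun fun i => ?_
  rw [Submodule.inner_orthogonalProjectionOnto_eq_of_mem_left,
    Submodule.inner_orthogonalProjectionOnto_eq_of_mem_right, hb]

end Complete

/-! ### Gap inequalities and spectra. -/

theorem re_inner_sub_smul (c : ℝ) (x y : H) :
    (inner ℂ x (y - (c : ℂ) • x)).re = (inner ℂ x y).re - c * ‖x‖ ^ 2 := by
  rw [inner_sub_right, inner_smul_right, Complex.sub_re, Complex.re_ofReal_mul,
    ← inner_self_eq_norm_sq (𝕜 := ℂ)]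
  rfl

theorem mul_norm_le_of_mul_sq_le_abs_re_inner {d : ℝ} {x y : H}
    (h : d * ‖x‖ ^ 2 ≤ |(inner ℂ x y).re|) : d * ‖x‖ ≤ ‖y‖ := by
  rcases (norm_nonneg x).eq_or_lt with h0 | h0
  · rw [← h0, mul_zero]
    exact norm_nonneg _
  · refine le_of_mul_le_mul_left ?_ h0
    calc ‖x‖ * (d * ‖x‖) = d * ‖x‖ ^ 2 := by ring
      _ ≤ |(inner ℂ x y).re| := h
      _ ≤ ‖x‖ * ‖y‖ := (Complex.abs_re_le_norm _).trans (norm_inner_le_norm _ _)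

/-- A symmetric operator is bounded below at every point of a gap. -/
theorem HasGap.exists_bound {S : H →ₗ.[ℂ] H} {J : Set ℝ} (hgap : HasGap S J) {c : ℝ} (hc : c ∈ J) :
    ∃ d > 0, ∀ f : S.domain, d * ‖(f : H)‖ ≤ ‖S f - (c : ℂ) • (f : H)‖ := by
  rcases hgap with ⟨b, rfl, hb⟩ | ⟨a, b, -, rfl, hab⟩ | ⟨a, rfl, ha⟩
  · refine ⟨b - c, sub_pos.2 hc, fun f => mul_norm_le_of_mul_sq_le_abs_re_inner ?_⟩
    refine le_trans ?_ (le_abs_self _)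
    rw [re_inner_sub_smul]
    linarith [hb f]
  · refine ⟨min (c - a) (b - c), lt_min (sub_pos.2 hc.1) (sub_pos.2 hc.2), fun f => ?_⟩
    have h1 : S f - (((a + b) / 2 : ℝ) : ℂ) • (f : H) =
        (S f - (c : ℂ) • (f : H)) + ((c - (a + b) / 2 : ℝ) : ℂ) • (f : H) := by
      push_cast
      module
    have h2 := hab f
    rw [h1] at h2
    have h3 := h2.trans (norm_add_le _ _)
    rw [norm_smul, Complex.norm_real, Real.norm_eq_abs] at h3
    -- The distance from `c` to the ends of the gap is the half-length minus the distance to the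
    -- midpoint, which is what the triangle inequality leaves.
    have h4 : min (c - a) (b - c) = (b - a) / 2 - |c - (a + b) / 2| := by
      rcases le_total c ((a + b) / 2) with h | h
      · rw [min_eq_left (by linarith), abs_of_nonpos (by linarith)]
        ring
      · rw [min_eq_right (by linarith), abs_of_nonneg (by linarith)]
        ring
    rw [h4]
    linarith
  · refine ⟨c - a, sub_pos.2 hc, fun f => mul_norm_le_of_mul_sq_le_abs_re_inner ?_⟩
    refine le_trans ?_ (neg_le_abs _)
    rw [re_inner_sub_smul]
    linarith [ha f]

/-- Limits of eigenvalues belong to the spectrum. -/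
theorem mem_spectrum_of_mem_closure_eigenvalues {A : H →ₗ.[ℂ] H} {ι : Type*} {e : ι → H}
    (he : ∀ i, ‖e i‖ = 1) {μ : ι → ℝ}
    (hA : ∀ i, ∃ hi : e i ∈ A.domain, A ⟨e i, hi⟩ = (μ i : ℂ) • e i) {t : ℝ}
    (ht : t ∈ closure (Set.range μ)) : (t : ℂ) ∈ spectrum A := by
  rintro ⟨R, -, hR⟩
  -- A bounded inverse `R` at `t` forces every eigenvalue to distance at least `1 / ‖R‖`; the `+ 1`
  -- covers `R = 0`.
  obtain ⟨_, ⟨i, rfl⟩, hi⟩ := Metric.mem_closure_iff.1 ht (‖R‖ + 1)⁻¹ (by positivity)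
  obtain ⟨hei, hAi⟩ := hA i
  have h1 := hR ⟨e i, hei⟩
  rw [hAi, ← sub_smul, map_smul] at h1
  have h2 : 1 ≤ dist t (μ i) * ‖R‖ := by
    calc (1 : ℝ) = ‖((μ i : ℂ) - t) • R (e i)‖ := by rw [h1, he]
      _ ≤ dist t (μ i) * ‖R‖ := by
        rw [norm_smul, ← Complex.ofReal_sub, Complex.norm_real, dist_comm, Real.dist_eq,
          Real.norm_eq_abs]
        exact mul_le_mul_of_nonneg_left (R.unit_le_opNorm _ (he i).le) (abs_nonneg _)
  have h3 : dist t (μ i) * (‖R‖ + 1) < 1 := by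
    rwa [← lt_div_iff₀ (by positivity), one_div]
  nlinarith [dist_nonneg (x := t) (y := μ i)]

/-- The closure of an open subset of `ℝ` has no isolated points, so no point of it can be discrete
spectrum, whatever the multiplicities. -/
theorem mem_essentialSpectrum_of_subset_spectrum {A : H →ₗ.[ℂ] H} {J : Set ℝ} (hJ : IsOpen J)
    (hA : ∀ t ∈ closure J, (t : ℂ) ∈ spectrum A) {t : ℝ} (ht : t ∈ closure J) :
    (t : ℂ) ∈ essentialSpectrum A := by
  refine ⟨hA t ht, fun h => h.2.1 ?_⟩
  have hacc := (hJ.perfect_closure.acc t ht).map Complex.continuous_ofReal.continuousAt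
    Complex.ofReal_injective
  refine hacc.mono ?_
  rw [Filter.map_principal, Filter.principal_mono]
  rintro _ ⟨s, hs, rfl⟩
  exact hA s hs

theorem HasGap.isOpen {S : H →ₗ.[ℂ] H} {J : Set ℝ} (hgap : HasGap S J) : IsOpen J := by
  rcases hgap with ⟨b, rfl, -⟩ | ⟨a, b, -, rfl, -⟩ | ⟨a, rfl, -⟩
  exacts [isOpen_Iio, isOpen_Ioo, isOpen_Ioi]

theorem HasGap.nonempty {S : H →ₗ.[ℂ] H} {J : Set ℝ} (hgap : HasGap S J) : J.Nonempty := by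
  rcases hgap with ⟨b, rfl, -⟩ | ⟨a, b, hab, rfl, -⟩ | ⟨a, rfl, -⟩
  exacts [Set.nonempty_Iio, Set.nonempty_Ioo.2 hab, Set.nonempty_Ioi]

variable [CompleteSpace H]

/-! ### Splitting off the span of the eigenvectors. -/

/-- The projection onto the closed linear span of a family of vectors. -/
noncomputable abbrev spanProjection {ι : Type*} (e : ι → H) : H →L[ℂ] H :=
  (Submodule.span ℂ (Set.range e)).topologicalClosure.starProjection

theorem spanProjection_apply_self {ι : Type*} (e : ι → H) (i : ι) : spanProjection e (e i) = e i :=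
  Submodule.starProjection_eq_self_iff.2
    (Submodule.le_topologicalClosure _ (Submodule.subset_span ⟨i, rfl⟩))

theorem inner_spanProjection_left {ι : Type*} (e : ι → H) (x y : H) :
    inner ℂ (spanProjection e x) y = inner ℂ x (spanProjection e y) :=
  Submodule.starProjection_isSymmetric _ x y

theorem spanProjection_idem {ι : Type*} (e : ι → H) (x : H) :
    spanProjection e (spanProjection e x) = spanProjection e x :=
  Submodule.starProjection_eq_self_iff.2 (Submodule.starProjection_apply_mem _ _)

theorem spanProjection_eq_zero {ι : Type*} {e : ι → H} {x : H} (hx : ∀ i, inner ℂ (e i) x = 0) :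
    spanProjection e x = 0 := by
  rw [Submodule.starProjection_apply_eq_zero_iff, Submodule.orthogonal_closure]
  have hle : Submodule.span ℂ (Set.range e) ≤ (ℂ ∙ x)ᗮ := by
    rw [Submodule.span_le]
    rintro _ ⟨i, rfl⟩
    rw [SetLike.mem_coe, Submodule.mem_orthogonal_singleton_iff_inner_left]
    exact hx i
  exact fun y hy => Submodule.mem_orthogonal_singleton_iff_inner_left.1 (hle hy)

theorem map_spanProjection_eq_zero {ι : Type*} {e : ι → H} {B : H →L[ℂ] H} (hBe : ∀ i, B (e i) = 0)
    (x : H) : B (spanProjection e x) = 0 := by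
  have hle : (Submodule.span ℂ (Set.range e)).topologicalClosure ≤ LinearMap.ker (B : H →ₗ[ℂ] H) :=
    Submodule.topologicalClosure_minimal _
      (Submodule.span_le.2 (Set.range_subset_iff.2 hBe)) B.isClosed_ker
  exact hle (Submodule.starProjection_apply_mem _ _)

theorem inner_sub_spanProjection {ι : Type*} (e : ι → H) (x y : H) :
    inner ℂ (x - spanProjection e x) (y - spanProjection e y) =
      inner ℂ x y - inner ℂ (spanProjection e x) y := by
  rw [inner_sub_left, inner_sub_right, inner_sub_right, inner_spanProjection_left,
    inner_spanProjection_left, spanProjection_idem]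
  ring

theorem norm_sub_spanProjection_sq {ι : Type*} (e : ι → H) (x : H) :
    ‖x - spanProjection e x‖ ^ 2 = ‖x‖ ^ 2 - (inner ℂ (spanProjection e x) x).re := by
  rw [← inner_self_eq_norm_sq (𝕜 := ℂ), ← inner_self_eq_norm_sq (𝕜 := ℂ) x,
    inner_sub_spanProjection]
  exact Complex.sub_re _ _

/-- The weak eigenvector equation turns Parseval into a sum with weights `μ i`, so estimates on the
span reduce to comparing weights termwise. -/
theorem hasSum_re_inner_spanProjection {ι : Type*} {e : ι → H} (he : Orthonormal ℂ e) {x y : H}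
    {μ : ι → ℝ} (hxy : ∀ i, inner ℂ (e i) y = μ i * inner ℂ (e i) x) :
    HasSum (fun i => μ i * ‖inner ℂ (e i) x‖ ^ 2) (inner ℂ (spanProjection e x) y).re := by
  refine (Complex.hasSum_re (hasSum_inner_mul_inner_starProjection he x y)).congr_fun fun i => ?_
  rw [hxy, mul_left_comm, ← inner_conj_symm x (e i), ← Complex.normSq_eq_conj_mul_self,
    Complex.normSq_eq_norm_sq, ← Complex.ofReal_mul, Complex.ofReal_re]

/-- Splitting off eigenvectors of the adjoint with eigenvalues in a gap preserves the gap. -/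
theorem HasGap.exists_bound_compression {S : H →ₗ.[ℂ] H} {J : Set ℝ} (hgap : HasGap S J)
    {ι : Type*} {e : ι → H} (he : Orthonormal ℂ e) {μ : ι → ℝ} (hμ : ∀ i, μ i ∈ J)
    (heig : ∀ i (f : S.domain), inner ℂ (e i) (S f) = μ i * inner ℂ (e i) (f : H)) :
    ∃ c d : ℝ, 0 < d ∧ ∀ f : S.domain, d * ‖(f : H) - spanProjection e f‖ ≤
      ‖(S f - (c : ℂ) • (f : H)) - spanProjection e (S f - (c : ℂ) • (f : H))‖ := by
  have heig' : ∀ (c : ℝ) i (f : S.domain), inner ℂ (e i) (S f - (c : ℂ) • (f : H)) =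
      ((μ i - c : ℝ) : ℂ) * inner ℂ (e i) (f : H) := fun c i f => by
    rw [inner_sub_right, inner_smul_right, heig]
    push_cast
    ring
  have hsum1 : ∀ x : H, HasSum (fun i => ‖inner ℂ (e i) x‖ ^ 2)
      (inner ℂ (spanProjection e x) x).re := fun x => by
    simpa using hasSum_re_inner_spanProjection he (x := x) (y := x) (μ := fun _ => 1) (by simp)
  have hsum2 := fun (c : ℝ) (f : S.domain) =>
    hasSum_re_inner_spanProjection he (fun i => heig' c i f)
  rcases hgap with ⟨b, rfl, hb⟩ | ⟨a, b, hlt, rfl, hab⟩ | ⟨a, rfl, ha⟩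
  -- With `c = b - 1` the form of `S - c` is at least `‖f‖²`, while its part on the span is at most
  -- `‖P f‖²` because `μ i - c < 1`; subtract.
  · refine ⟨b - 1, 1, one_pos, fun f =>
      mul_norm_le_of_mul_sq_le_abs_re_inner (le_trans ?_ (le_abs_self _))⟩
    rw [one_mul, inner_sub_spanProjection, norm_sub_spanProjection_sq, Complex.sub_re,
      re_inner_sub_smul]
    have h := hasSum_le (fun i => ?_) (hsum2 (b - 1) f) (hsum1 f)
    · linarith [hb f]
    · have : μ i < b := hμ i
      exact mul_le_of_le_one_left (sq_nonneg _) (by linarith)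
  · refine ⟨(a + b) / 2, (b - a) / 2, by linarith, fun f => ?_⟩
    have hd : 0 ≤ (b - a) / 2 := by linarith
    refine le_of_sq_le_sq ?_ (norm_nonneg _)
    rw [mul_pow, norm_sub_spanProjection_sq, norm_sub_spanProjection_sq]
    have h1 := pow_le_pow_left₀ (by positivity) (hab f) 2
    rw [mul_pow] at h1
    -- With `c` the midpoint, `|μ i - c|` is below the half-length, so the span part of `(S - c) f`
    -- is at most the half-length times `‖P f‖`; subtract the squares.
    have h := hasSum_le (fun i => ?_) (hsum1 (S f - (((a + b) / 2 : ℝ) : ℂ) • (f : H)))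
      ((hsum1 f).mul_left (((b - a) / 2) ^ 2))
    · linarith
    · rw [heig', norm_mul, mul_pow, Complex.norm_real, Real.norm_eq_abs, sq_abs]
      refine mul_le_mul_of_nonneg_right (sq_le_sq' ?_ ?_) (sq_nonneg _)
      · linarith [(hμ i).1]
      · linarith [(hμ i).2]
  · refine ⟨a + 1, 1, one_pos, fun f =>
      mul_norm_le_of_mul_sq_le_abs_re_inner (le_trans ?_ (neg_le_abs _))⟩
    rw [one_mul, inner_sub_spanProjection, norm_sub_spanProjection_sq, Complex.sub_re,
      re_inner_sub_smul]
    have h := hasSum_le (fun i => ?_) (hsum1 f).neg (hsum2 (a + 1) f)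
    · linarith [ha f]
    · have : a < μ i := hμ i
      rw [← neg_one_mul]
      exact mul_le_mul_of_nonneg_right (by linarith) (sq_nonneg _)

/-! ### The self-adjoint extension with prescribed eigenvectors. -/

/-- The graph of the operator which acts as multiplication by `μ i` on `e i` and as `c + B⁻¹`
on the orthogonal complement of all `e i`. -/
def diagonalSumInverseGraph {ι : Type*} (e : ι → H) (μ : ι → ℝ) (B : H →L[ℂ] H) (c : ℝ) :
    Submodule ℂ (H × H) where
  carrier := {x | (∀ i, inner ℂ (e i) x.2 = μ i * inner ℂ (e i) x.1) ∧
    B (x.2 - (c : ℂ) • x.1) = x.1 - spanProjection e x.1}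
  zero_mem' := by simp
  add_mem' := by
    rintro x y ⟨hx, hx'⟩ ⟨hy, hy'⟩
    refine ⟨fun i => ?_, ?_⟩
    · rw [Prod.snd_add, Prod.fst_add, inner_add_right, inner_add_right, hx, hy]
      ring
    · rw [Prod.snd_add, Prod.fst_add, smul_add, add_sub_add_comm, map_add, hx', hy', map_add,
        add_sub_add_comm]
  smul_mem' := by
    rintro k x ⟨hx, hx'⟩
    refine ⟨fun i => ?_, ?_⟩
    · rw [Prod.smul_snd, Prod.smul_fst, inner_smul_right, inner_smul_right, hx]
      ring
    · rw [Prod.smul_snd, Prod.smul_fst, smul_comm, ← smul_sub, map_smul, hx', map_smul, smul_sub]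

theorem mem_diagonalSumInverseGraph_eigenvector {ι : Type*} {e : ι → H} (he : Orthonormal ℂ e)
    (μ : ι → ℝ) {B : H →L[ℂ] H} (hBe : ∀ i, B (e i) = 0) (c : ℝ) (i : ι) :
    (e i, (μ i : ℂ) • e i) ∈ diagonalSumInverseGraph e μ B c := by
  refine ⟨fun j => ?_, ?_⟩
  · rw [inner_smul_right]
    rcases eq_or_ne j i with rfl | hji
    · rfl
    · rw [he.2 hji, mul_zero, mul_zero]
  · rw [map_sub, map_smul, map_smul, hBe, spanProjection_apply_self, smul_zero, smul_zero,
      sub_self, sub_self]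

/-- Testing against the eigenvectors gives the first defining condition, testing against the graph
of `c + B⁻¹` the second. Conversely, symmetry holds on the span since the `μ i` are real, and on its
complement since `B` is symmetric. -/
theorem adjoint_diagonalSumInverseGraph {ι : Type*} {e : ι → H} (he : Orthonormal ℂ e) (μ : ι → ℝ)
    {B : H →L[ℂ] H} (hB : ∀ x y, inner ℂ (B x) y = inner ℂ x (B y)) (hBe : ∀ i, B (e i) = 0)
    (c : ℝ) :
    (diagonalSumInverseGraph e μ B c).adjoint = diagonalSumInverseGraph e μ B c := by
  have hPB : ∀ x, spanProjection e (B x) = 0 := fun x => spanProjection_eq_zero fun i => by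
    rw [← hB, hBe, inner_zero_left]
  ext ⟨f, h⟩
  rw [Submodule.mem_adjoint_iff]
  refine ⟨fun hadj => ⟨fun i => ?_, ?_⟩, ?_⟩
  · have := hadj _ _ (mem_diagonalSumInverseGraph_eigenvector he μ hBe c i)
    rw [inner_smul_left, Complex.conj_ofReal] at this
    exact (sub_eq_zero.1 this).symm
  · refine ext_inner_left ℂ fun x => ?_
    have hmem : (B x, (c : ℂ) • B x + (x - spanProjection e x)) ∈
        diagonalSumInverseGraph e μ B c := by
      refine ⟨fun j => ?_, ?_⟩
      · have h1 : inner ℂ (e j) (B x) = 0 := by rw [← hB, hBe, inner_zero_left]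
        have h2 : inner ℂ (e j) (x - spanProjection e x) = 0 := by
          rw [inner_sub_right, ← inner_spanProjection_left, spanProjection_apply_self, sub_self]
        rw [inner_add_right, inner_smul_right, h1, h2, mul_zero, mul_zero, add_zero]
      · rw [add_sub_cancel_left, map_sub, map_spanProjection_eq_zero hBe, hPB]
    have := hadj _ _ hmem
    rw [inner_add_left, inner_smul_left, Complex.conj_ofReal, hB, hB, inner_sub_left,
      inner_spanProjection_left] at this
    rw [map_sub, map_smul, inner_sub_right, inner_smul_right, inner_sub_right]
    linear_combination -this
  · rintro ⟨h1, h2⟩ a b ⟨h3, h4⟩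
    have hP : inner ℂ (spanProjection e b) f = inner ℂ (spanProjection e a) h := by
      refine (hasSum_inner_mul_inner_starProjection he b f).unique ?_
      refine (hasSum_inner_mul_inner_starProjection he a h).congr_fun fun i => ?_
      rw [h1, ← inner_conj_symm b (e i), h3, map_mul, Complex.conj_ofReal, inner_conj_symm]
      ring
    have h5 : inner ℂ (b - (c : ℂ) • a) (f - spanProjection e f) =
        inner ℂ (a - spanProjection e a) (h - (c : ℂ) • f) := by
      rw [← h2, ← h4, hB]
    simp only [inner_sub_left, inner_sub_right, inner_smul_left, inner_smul_right,
      Complex.conj_ofReal, ← inner_spanProjection_left] at h5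
    linear_combination h5 + hP

/-- A symmetric operator with orthonormal eigenvectors `e i` of its adjoint, whose compression to
the orthogonal complement of these is bounded below at a real point, has a self-adjoint extension
with the eigenvectors `e i`. -/
theorem exists_selfAdjoint_extension_eigenvectors {S : H →ₗ.[ℂ] H}
    (hdense : Dense (S.domain : Set H)) (hsymm : S.IsFormalAdjoint S)
    {ι : Type*} {e : ι → H} (he : Orthonormal ℂ e) {μ : ι → ℝ}
    (heig : ∀ i (f : S.domain), inner ℂ (e i) (S f) = μ i * inner ℂ (e i) (f : H))
    {c d : ℝ} (hd : 0 < d) (hbound : ∀ f : S.domain, d * ‖(f : H) - spanProjection e f‖ ≤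
      ‖(S f - (c : ℂ) • (f : H)) - spanProjection e (S f - (c : ℂ) • (f : H))‖) :
    ∃ A : H →ₗ.[ℂ] H, S ≤ A ∧ IsSelfAdjoint A ∧
      ∀ i, ∃ hi : e i ∈ A.domain, A ⟨e i, hi⟩ = (μ i : ℂ) • e i := by
  set p : H →ₗ[ℂ] H := LinearMap.id - (spanProjection e : H →ₗ[ℂ] H) with hp
  have hpx : ∀ x, p x = x - spanProjection e x := fun x => rfl
  have hpe : ∀ i x, inner ℂ (p x) (e i) = 0 := fun i x => by
    rw [hpx, inner_sub_left, inner_spanProjection_left, spanProjection_apply_self, sub_self]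
  have hP : ∀ f g : S.domain, inner ℂ (spanProjection e (S f)) (g : H) =
      inner ℂ (spanProjection e f) (S g) := fun f g => by
    refine (hasSum_inner_mul_inner_starProjection he (S f) g).unique ?_
    refine (hasSum_inner_mul_inner_starProjection he f (S g)).congr_fun fun i => ?_
    rw [heig, ← inner_conj_symm (S f) (e i), heig, map_mul, Complex.conj_ofReal, inner_conj_symm]
    ring
  obtain ⟨B, hB, hBS, hB0⟩ := exists_selfAdjoint_extension_of_bound
    (p ∘ₗ (S.toFun - (c : ℂ) • S.domain.subtype)) (p ∘ₗ S.domain.subtype) hd hbound (by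
      intro f g
      change inner ℂ (S f - (c : ℂ) • (f : H) - spanProjection e (S f - (c : ℂ) • (f : H)))
          ((g : H) - spanProjection e g) = inner ℂ ((f : H) - spanProjection e f)
          (S g - (c : ℂ) • (g : H) - spanProjection e (S g - (c : ℂ) • (g : H)))
      rw [inner_sub_spanProjection, inner_sub_spanProjection]
      simp only [map_sub, map_smul, inner_sub_left, inner_sub_right, inner_smul_left,
        inner_smul_right, Complex.conj_ofReal]
      linear_combination hsymm f g - hP f g)
  have hBS' : ∀ f : S.domain,
      B (S f - (c : ℂ) • (f : H) - spanProjection e (S f - (c : ℂ) • (f : H))) =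
        (f : H) - spanProjection e f := hBS
  have hBe : ∀ i, B (e i) = 0 := fun i => hB0 _ (fun f => hpe _ _) (fun f => hpe _ _)
  set G := diagonalSumInverseGraph e μ B c with hG
  have hSG : ∀ f : S.domain, ((f : H), S f) ∈ G := fun f => by
    refine ⟨fun i => heig i f, ?_⟩
    change B (S f - (c : ℂ) • (f : H)) = _
    rw [← hBS' f, map_sub B (_ - _), map_spanProjection_eq_zero hBe, sub_zero]
  -- `B` may have a kernel beyond the `e i`, so single-valuedness needs density: such a vector is
  -- orthogonal to the `e i` and to the range of `B`, hence to the domain of `S`.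
  have hzero : ∀ x ∈ G, x.1 = 0 → x.2 = 0 := by
    rintro ⟨f, h⟩ ⟨h1, h2⟩ (rfl : f = 0)
    simp only [inner_zero_right, mul_zero, smul_zero, sub_zero, map_zero] at h1 h2
    refine hdense.eq_zero_of_inner_left ℂ fun f hf => ?_
    have h3 : spanProjection e h = 0 := spanProjection_eq_zero h1
    have h4 : inner ℂ h (f - spanProjection e f) = 0 := by
      rw [← hBS' ⟨f, hf⟩, ← hB, h2, inner_zero_left]
    rwa [inner_sub_right, ← inner_spanProjection_left, h3, inner_zero_left, sub_zero] at h4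
  have hgraph : G.toLinearPMap.graph = G := Submodule.toLinearPMap_graph_eq G hzero
  have hle : S ≤ G.toLinearPMap := by
    rw [← LinearPMap.le_graph_iff, hgraph]
    rintro ⟨f, h⟩ hfh
    obtain ⟨y, rfl, rfl⟩ := (LinearPMap.mem_graph_iff _).1 hfh
    exact hSG y
  refine ⟨G.toLinearPMap, hle, ?_, fun i => ?_⟩
  · rw [LinearPMap.isSelfAdjoint_def]
    refine LinearPMap.eq_of_eq_graph ?_
    rw [LinearPMap.adjoint_graph_eq_graph_adjoint (hdense.mono hle.1), hgraph,
      adjoint_diagonalSumInverseGraph he μ hB hBe c]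
  · have hmem : (e i, (μ i : ℂ) • e i) ∈ G.toLinearPMap.graph := by
      rw [hgraph]
      exact mem_diagonalSumInverseGraph_eigenvector he μ hBe c i
    obtain ⟨y, hy1, hy2⟩ := (LinearPMap.mem_graph_iff _).1 hmem
    simp only at hy1 hy2
    have hyd : e i ∈ G.toLinearPMap.domain := hy1 ▸ y.2
    refine ⟨hyd, ?_⟩
    rw [← hy2]
    congr 1
    exact Subtype.ext hy1.symm

end UnboundedOperator

theorem mainTheorem2 {H : Type*} [NormedAddCommGroup H] [InnerProductSpace ℂ H] [CompleteSpace H]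
    (S : H →ₗ.[ℂ] H) (hdense : Dense (S.domain : Set H)) (hsymm : S.IsFormalAdjoint S)
    (J : Set ℝ) (hgap : UnboundedOperator.HasGap S J)
    (hdef : UnboundedOperator.HasInfiniteDeficiencyIndex S)
    (K : Set ℝ) (hKclosed : IsClosed K) (hK : K ⊆ closure J) :
    ∃ A : H →ₗ.[ℂ] H, S ≤ A ∧ IsSelfAdjoint A ∧
      ∀ t ∈ K, (t : ℂ) ∈ UnboundedOperator.essentialSpectrum A := by
  have := hgap.nonempty.to_subtype
  -- Repetitions among the `μ n` are harmless: orthogonality of the `e n` comes from the selection,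
  -- not from distinct eigenvalues.
  set μ : ℕ → ℝ := fun n => TopologicalSpace.denseSeq J n with hμ
  have hμJ : ∀ n, μ n ∈ J := fun n => Subtype.coe_prop _
  have hclosure : closure J ⊆ closure (Set.range μ) := by
    refine closure_minimal (fun t ht => ?_) isClosed_closure
    have h := TopologicalSpace.denseRange_denseSeq J ⟨t, ht⟩
    rwa [closure_subtype, ← Set.range_comp] at h
  obtain ⟨e, he, heV⟩ := UnboundedOperator.exists_orthonormal_mem fun n => by
    obtain ⟨d, hd, hbound⟩ := hgap.exists_bound (hμJ n)
    exact UnboundedOperator.not_finiteDimensional_orthogonal_range_sub hdense hsymm hdef.1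
      (μ n) hd hbound
  have heig : ∀ n (f : S.domain), inner ℂ (e n) (S f) = μ n * inner ℂ (e n) (f : H) := by
    intro n f
    have h : inner ℂ (e n) (S f - (μ n : ℂ) • (f : H)) = 0 :=
      (Submodule.mem_orthogonal' _ _).1 (heV n) _ ⟨f, rfl⟩
    rwa [inner_sub_right, inner_smul_right, sub_eq_zero] at h
  obtain ⟨c, d, hd, hbound⟩ := hgap.exists_bound_compression he hμJ heig
  obtain ⟨A, hSA, hA, hAe⟩ :=
    UnboundedOperator.exists_selfAdjoint_extension_eigenvectors hdense hsymm he heig hd hbound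
  refine ⟨A, hSA, hA, fun t ht =>
    UnboundedOperator.mem_essentialSpectrum_of_subset_spectrum hgap.isOpen
    (fun s hs => ?_) (hK ht)⟩
  exact UnboundedOperator.mem_spectrum_of_mem_closure_eigenvalues he.1 hAe (hclosure hs)
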